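/- Let $(S,A,P)$ be a Markov decision process with finite state set $S$, finite action set $A$ and transition probabilities $P(s,a,s_+)$. Let $r:S\times A\to\mathbb R$ be the reward function, $r^1,\dots,r^J:S\times A\to\mathbb R$ the constraint functions and $\gamma\in(0,1)$ the discount factor. Let $\Pi$ be the set of stationary randomized policies, i.e. maps from $S$ to probability distributions on $A$. For an initial state $s$, consider the peak-constrained problem of maximizing over $\pi\in\Pi$ $$\sum_{k=0}^\infty\gamma^k\,\mathbf E\big(r(s_k,a_k)\big)\quad\text{subject to}\quad r^j(s_k,a_k)\ge 0\ \text{ almost surely for all } k\in\mathbb N,\ j=1,\dots,J,\qquad s_0=s,$$ where $a_k$ is drawn from $\pi(s_k)$ and $s_{k+1}$ from $P(s_k,a_k,\cdot)$. Assume that - the problem is feasible, i.e. some $\pi\in\Pi$ satisfies the constraints; - the MDP is unichain: under every policy in $\Pi$, each state is reachable from any other state; - $|r|\le c$ and $|r^j|\le c$ for all $j$, for some constant $c$; - $r(s,a)>0$ for all $(s,a)\in S\times A$. Put $C=c\gamma/(1-\gamma)$, $R(s,a,\lambda)=r(s,a)+\sum_{j=1}^J\lambda^jr^j(s,a)$ and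 $$R(s,a)=\max\Big(-C,\ \min_{\lambda\ge0}R(s,a,\lambda)\Big),$$ where the minimum over $\lambda\in\mathbb R^J$, $\lambda\ge 0$, is an infimum that may be $-\infty$. Then the truncated Bellman equation $$Q^\star(s,a)=R(s,a)+\gamma\max_{\pi\in\Pi}\mathbf E\big(Q^\star(s_+,\pi(s_+))\big),\qquad s_+\sim P(s,a,\cdot),\quad (s,a)\in S\times A,$$ has a unique solution $Q^\star$, and the following hold. 1. Let $(s_k,a_k)_{k\ge0}$ be a state-action process on a probability space, with any initial distribution, and let $\alpha_k$ be real step sizes, both adapted to a filtration $(\mathcal F_k)$ such that $\Pr(s_{k+1}=s'\mid\mathcal F_k)=P(s_k,a_k,s')$ for all $k$ and $s'$. Suppose that almost surely, for all $(s,a)$, the numbers $\alpha_k(s,a)=\alpha_k\mathbf 1_{\{(s_k,a_k)=(s,a)\}}$ satisfy $0\le\alpha_k(s,a)<1$ for all $k$, $\sum_k\alpha_k(s,a)=\infty$ and $\sum_k\alpha_k(s,a)^2<\infty$. Then, for every initial table $Q_0:S\times A\to\mathbb R$, the iterates $$Q_{k+1}(s,a)=(1-\alpha_k(s,a))Q_k(s,a)+\alpha_k(s,a)\Big(R(s,a)+\gamma\max_{a'\in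 A}Q_k(s_{k+1},a')\Big)$$ converge almost surely to $Q^\star(s,a)$, for all $(s,a)$. 2. There is a policy $\pi^\star\in\Pi$ with $\pi^\star(s)\in\operatorname{argmax}_{\pi\in\Pi}\mathbf E\big(Q^\star(s,\pi(s))\big)$ for all $s\in S$, and every such policy is an optimal solution of the constrained problem. -/

import Mathlib

open MeasureTheory ProbabilityTheory Filter Topology

noncomputable section

/-- A finite Markov decision process with reward `r` and peak-constraint functions
`r^1, …, r^J`. `transition s a` is the law `P(s, a, ·)` of the next state. -/
structure PeakMDP (S A : Type*) (J : ℕ) where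
  transition : S → A → PMF S
  reward : S → A → ℝ
  constr : Fin J → S → A → ℝ

/-- The set `Π` of stationary randomized policies. -/
abbrev Policy (S A : Type*) := S → PMF A

/-- Expectation of `f` under a probability mass function on a finite type. -/
def pmfExp {X : Type*} [Fintype X] (p : PMF X) (f : X → ℝ) : ℝ :=
  ∑ x, (p x).toReal * f x

namespace PeakMDP

variable {S A : Type*} {J : ℕ} (M : PeakMDP S A J)

section Dynamics

variable [Fintype S] [MeasurableSpace S] [MeasurableSingletonClass S]
  [Fintype A] [MeasurableSpace A] [MeasurableSingletonClass A]

/-- One-step law of `(s_{k+1}, a_{k+1})` given the history `(s_0, a_0), …, (s_k, a_k)`, when the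
actions are chosen by the stationary policy `π`. -/
def stepKernel (π : Policy S A) (n : ℕ) :
    Kernel ((_ : Finset.Iic n) → S × A) (S × A) :=
  Kernel.ofFunOfCountable fun h =>
    (((M.transition (h ⟨n, Finset.mem_Iic.2 le_rfl⟩).1 (h ⟨n, Finset.mem_Iic.2 le_rfl⟩).2).bind
      fun s' => (π s').map fun a' => (s', a'))).toMeasure

instance stepKernel_isMarkovKernel (π : Policy S A) (n : ℕ) :
    IsMarkovKernel (M.stepKernel π n) :=
  ⟨fun _ => PMF.toMeasure.isProbabilityMeasure _⟩

/-- The law of the whole trajectory `(s_k, a_k)_{k ≥ 0}` with `s_0 = s` under the policy `π`. -/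
def trajLaw (π : Policy S A) (s : S) : Measure (ℕ → S × A) :=
  Kernel.trajMeasure (X := fun _ => S × A) ((π s).map fun a => (s, a)).toMeasure (M.stepKernel π)

/-- Every policy induces a Markov chain in which each state is reachable from any other state. -/
def IsUnichain : Prop :=
  ∀ (π : Policy S A) (s s' : S), ∃ n : ℕ, 0 < M.trajLaw π s {ω | (ω n).1 = s'}

/-- The discounted objective `∑ₖ γ^k E[r(s_k, a_k)]` with `s_0 = s`. -/
def value (γ : ℝ) (π : Policy S A) (s : S) : ℝ :=
  ∑' k : ℕ, γ ^ k * ∫ ω, M.reward (ω k).1 (ω k).2 ∂(M.trajLaw π s)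

/-- The policy satisfies all peak constraints `r^j(s_k, a_k) ≥ 0` almost surely when `s_0 = s`. -/
def IsFeasible (π : Policy S A) (s : S) : Prop :=
  ∀ᵐ ω ∂(M.trajLaw π s), ∀ (k : ℕ) (j : Fin J), 0 ≤ M.constr j (ω k).1 (ω k).2

/-- `π` is an optimal solution of the peak-constrained problem with initial state `s`. -/
def IsOptimal (γ : ℝ) (π : Policy S A) (s : S) : Prop :=
  M.IsFeasible π s ∧ ∀ π' : Policy S A, M.IsFeasible π' s → M.value γ π' s ≤ M.value γ π s

end Dynamics

/-- `R(s, a, λ) = r(s, a) + ∑ⱼ λ^j r^j(s, a)`. -/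
def lagrangian (s : S) (a : A) (l : Fin J → ℝ) : ℝ :=
  M.reward s a + ∑ j, l j * M.constr j s a

/-- `max (-C, min_{λ ≥ 0} R(s, a, λ))`. The inner infimum is taken in the extended reals, where it
may be `-∞`; the maximum with `-C` is always a real number. -/
def truncReward (C : ℝ) (s : S) (a : A) : ℝ :=
  (max ((-C : ℝ) : EReal) (⨅ l : {l : Fin J → ℝ // 0 ≤ l}, (M.lagrangian s a l.1 : EReal))).toReal

/-- `Q` solves the truncated Bellman equation
`Q(s, a) = R(s, a) + γ max_{π ∈ Π} E[Q(s₊, π(s₊))]`. -/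
def IsBellmanSolution [Fintype S] [Fintype A] (γ C : ℝ) (Q : S → A → ℝ) : Prop :=
  ∀ (s : S) (a : A), ∃ v : ℝ,
    IsGreatest (Set.range fun π : Policy S A =>
      pmfExp (M.transition s a) fun s' => pmfExp (π s') (Q s')) v ∧
    Q s a = M.truncReward C s a + γ * v

end PeakMDP

/-- `π(s)` maximizes `E[Q(s, π(s))]` over all policies, for every state `s`. -/
def IsGreedy {S A : Type*} [Fintype A] (Q : S → A → ℝ) (π : Policy S A) : Prop :=
  ∀ (s : S) (π' : Policy S A), pmfExp (π' s) (Q s) ≤ pmfExp (π s) (Q s)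

/-- `(s_k, a_k)` is a state-action process of the MDP with information flow `ℱ`: actions may depend
on the past and on extra randomization in any way, and given `ℱ k`, which contains the past and
`(s_k, a_k)`, the next state has law `P(s_k, a_k, ·)`. -/
structure IsControlledProcess {S A Ω : Type*} {J : ℕ} [MeasurableSpace S] [MeasurableSpace A]
    {mΩ : MeasurableSpace Ω} (M : PeakMDP S A J) (μ : Measure Ω) (ℱ : Filtration ℕ mΩ)
    (st : ℕ → Ω → S) (act : ℕ → Ω → A) : Prop where
  measurable_state : ∀ k, Measurable[ℱ k] (st k)
  measurable_action : ∀ k, Measurable[ℱ k] (act k)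
  transition_law : ∀ (k : ℕ) (s' : S),
    μ⟦st (k + 1) ⁻¹' {s'} | ℱ k⟧ =ᵐ[μ] fun ω => (M.transition (st k ω) (act k ω) s').toReal

section Learning

variable {S A : Type*} [DecidableEq S] [DecidableEq A]

/-- `α_k(s, a) = α_k 1_{(s, a)}(s_k, a_k)` along one realization of states, actions and steps. -/
def stepSize (st : ℕ → S) (act : ℕ → A) (α : ℕ → ℝ) (k : ℕ) (s : S) (a : A) : ℝ :=
  if st k = s ∧ act k = a then α k else 0

/-- The Robbins–Monro conditions on the step sizes, for every state-action pair. -/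
def IsRobbinsMonro (st : ℕ → S) (act : ℕ → A) (α : ℕ → ℝ) : Prop :=
  ∀ (s : S) (a : A),
    (∀ k, 0 ≤ stepSize st act α k s a ∧ stepSize st act α k s a < 1) ∧
    Tendsto (fun n => ∑ k ∈ Finset.range n, stepSize st act α k s a) atTop atTop ∧
    Summable fun k => stepSize st act α k s a ^ 2

/-- The `Q`-learning iterates with reward `R`, started from the table `Q₀`. For a nonempty finite
action set, `⨆ a'` is the maximum over the actions. -/
def qLearning (R : S → A → ℝ) (γ : ℝ) (st : ℕ → S) (act : ℕ → A) (α : ℕ → ℝ) (Q₀ : S → A → ℝ) :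
    ℕ → S → A → ℝ
  | 0 => Q₀
  | k + 1 => fun s a =>
      (1 - stepSize st act α k s a) * qLearning R γ st act α Q₀ k s a +
        stepSize st act α k s a *
          (R s a + γ * ⨆ a' : A, qLearning R γ st act α Q₀ k (st (k + 1)) a')

end Learning

end

/-!
The Bellman operator `Q ↦ R + γ E[max_a Q(s₊, a)]` contracts the sup norm by `γ`
(`PeakMDP.contractingWith_bellmanOp`), so it has a unique fixed point `Q⋆`. A deterministic choice
of maximizing actions attains the maximum over randomized policies, whence fixed points are the
solutions of the truncated Bellman equation (`PeakMDP.isBellmanSolution_iff`).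

*Optimality.* The truncated reward is `r` on the pairs that satisfy all constraints and `-C` on the
others. Since `R ≤ c`, one has `max_a Q⋆ ≤ c / (1 - γ)`, and so `Q⋆ ≤ -C + γ c / (1 - γ) = 0` on
every violating pair. The unichain condition and one feasible policy give each state an admissible
action, and positivity of `r` then makes `Q⋆` positive there. Hence greedy policies take only
admissible actions (`PeakMDP.admissible_of_eq_iSup`). Along a feasible policy `r = R` almost surely,
so telescoping the Bellman equation bounds its value by `max_a Q⋆(s, a)`, with equality for a greedy
policy (`PeakMDP.tsum_discounted_le`, `PeakMDP.le_tsum_discounted`).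

*Learning.* A Q-learning step is a relaxed Bellman step plus a martingale difference. The iterates
are bounded, and the steps are square-summable, so after localization the noise series is an
`L²`-bounded martingale and converges almost surely (`ae_tendsto_sum_mul_of_summable_sq`). The rest
is deterministic: adding the tail of the noise series to `Q_k - Q⋆` turns the recursion into an
asynchronous contraction with vanishing errors, in which divergence of the step sums improves every
eventual bound `b` to any bound above `γ b` (`tendsto_zero_of_asynchronous_contraction`).
-/

/-! ### Finite expectations and maxima -/

section Expectation

variable {X : Type*} [Fintype X]

lemma PMF.sum_toReal_eq_one (p : PMF X) : ∑ x, (p x).toReal = 1 := by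
  rw [← ENNReal.toReal_sum fun x _ => p.apply_ne_top x,
    ← tsum_fintype (L := .unconditional X), p.tsum_coe, ENNReal.toReal_one]

lemma pmfExp_mono (p : PMF X) {f g : X → ℝ} (h : ∀ x, p x ≠ 0 → f x ≤ g x) :
    pmfExp p f ≤ pmfExp p g := by
  refine Finset.sum_le_sum fun x _ => ?_
  by_cases hx : p x = 0
  · simp [hx]
  · exact mul_le_mul_of_nonneg_left (h x hx) ENNReal.toReal_nonneg

lemma pmfExp_congr (p : PMF X) {f g : X → ℝ} (h : ∀ x, p x ≠ 0 → f x = g x) :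
    pmfExp p f = pmfExp p g :=
  (pmfExp_mono p fun x hx => (h x hx).le).antisymm (pmfExp_mono p fun x hx => (h x hx).ge)

lemma pmfExp_const (p : PMF X) (b : ℝ) : pmfExp p (fun _ => b) = b := by
  rw [pmfExp, ← Finset.sum_mul, p.sum_toReal_eq_one, one_mul]

lemma pmfExp_sub (p : PMF X) (f g : X → ℝ) :
    pmfExp p f - pmfExp p g = pmfExp p fun x => f x - g x := by
  simp only [pmfExp, ← Finset.sum_sub_distrib, mul_sub]

lemma pmfExp_pure (x : X) (f : X → ℝ) : pmfExp (PMF.pure x) f = f x := by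
  classical
  rw [pmfExp, Finset.sum_eq_single x] <;> simp +contextual [PMF.pure_apply]

lemma abs_pmfExp_le (p : PMF X) {f : X → ℝ} {b : ℝ} (h : ∀ x, |f x| ≤ b) : |pmfExp p f| ≤ b := by
  rw [abs_le]
  constructor
  · simpa [pmfExp_const] using pmfExp_mono p (f := fun _ => -b) fun x _ => (abs_le.1 (h x)).1
  · simpa [pmfExp_const] using pmfExp_mono p (g := fun _ => b) fun x _ => (abs_le.1 (h x)).2

lemma le_iSup_of_fintype (f : X → ℝ) (x : X) : f x ≤ ⨆ y, f y :=
  le_ciSup (Set.finite_range f).bddAbove x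

lemma pmfExp_le_iSup (p : PMF X) (f : X → ℝ) : pmfExp p f ≤ ⨆ x, f x := by
  simpa [pmfExp_const] using pmfExp_mono p (g := fun _ => ⨆ y, f y)
    fun x _ => le_iSup_of_fintype f x

/-- A distribution attaining the maximum puts no mass outside the maximizers. -/
lemma eq_iSup_of_pmfExp_eq {p : PMF X} {f : X → ℝ} (h : pmfExp p f = ⨆ x, f x) {x : X}
    (hx : p x ≠ 0) : f x = ⨆ y, f y := by
  have h0 : ∑ y, (p y).toReal * ((⨆ z, f z) - f y) = 0 := by
    have := pmfExp_sub p (fun _ => ⨆ z, f z) f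
    rw [pmfExp_const, h, sub_self] at this
    exact this.symm
  have h1 := (Finset.sum_eq_zero_iff_of_nonneg fun y _ =>
    mul_nonneg ENNReal.toReal_nonneg (sub_nonneg.2 (le_iSup_of_fintype f y))).1 h0 x
      (Finset.mem_univ x)
  rcases mul_eq_zero.1 h1 with h2 | h2
  · exact absurd h2 (ENNReal.toReal_ne_zero.2 ⟨hx, p.apply_ne_top x⟩)
  · linarith

variable [Nonempty X]

lemma abs_iSup_le {f : X → ℝ} {b : ℝ} (h : ∀ x, |f x| ≤ b) : |⨆ x, f x| ≤ b := by
  obtain ⟨x, hx⟩ := exists_eq_ciSup_of_finite (f := f)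
  exact hx ▸ h x

lemma abs_iSup_sub_iSup_le {f g : X → ℝ} {b : ℝ} (h : ∀ x, |f x - g x| ≤ b) :
    |(⨆ x, f x) - ⨆ x, g x| ≤ b := by
  obtain ⟨x, hx⟩ := exists_eq_ciSup_of_finite (f := f)
  obtain ⟨y, hy⟩ := exists_eq_ciSup_of_finite (f := g)
  have h1 := (abs_le.1 (h x)).2
  have h2 := (abs_le.1 (h y)).1
  have h3 := le_iSup_of_fintype f y
  have h4 := le_iSup_of_fintype g x
  rw [abs_le]
  constructor <;> linarith

end Expectation

/-! ### The truncated Bellman equation -/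

section Greedy

variable {S A : Type*} [Fintype A] [Nonempty A]

/-- A deterministic policy choosing a maximizing action attains the maximum over all randomized
policies, in every state at once. -/
lemma exists_policy_pmfExp_eq_iSup (Q : S → A → ℝ) :
    ∃ π : Policy S A, ∀ s, pmfExp (π s) (Q s) = ⨆ a, Q s a := by
  choose a ha using fun s => exists_eq_ciSup_of_finite (f := Q s)
  exact ⟨fun s => PMF.pure (a s), fun s => (pmfExp_pure _ _).trans (ha s)⟩

lemma exists_isGreedy (Q : S → A → ℝ) : ∃ π : Policy S A, IsGreedy Q π := by
  obtain ⟨π, hπ⟩ := exists_policy_pmfExp_eq_iSup Q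
  exact ⟨π, fun s π' => (hπ s).symm ▸ pmfExp_le_iSup _ _⟩

lemma IsGreedy.pmfExp_eq_iSup {Q : S → A → ℝ} {π : Policy S A} (h : IsGreedy Q π) (s : S) :
    pmfExp (π s) (Q s) = ⨆ a, Q s a := by
  obtain ⟨π', hπ'⟩ := exists_policy_pmfExp_eq_iSup Q
  exact (pmfExp_le_iSup _ _).antisymm (hπ' s ▸ h s π')

end Greedy

namespace PeakMDP

variable {S A : Type*} {J : ℕ} (M : PeakMDP S A J)

/-- The state-action pair `(s, a)` satisfies every peak constraint. -/
def Admissible (s : S) (a : A) : Prop := ∀ j, 0 ≤ M.constr j s a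

variable {M}

/-- On an admissible pair the infimum over the multipliers is attained at `λ = 0`. -/
lemma truncReward_of_admissible {s : S} {a : A} {C : ℝ} (h : M.Admissible s a)
    (hC : -C ≤ M.reward s a) : M.truncReward C s a = M.reward s a := by
  have : (⨅ l : {l : Fin J → ℝ // 0 ≤ l}, (M.lagrangian s a l.1 : EReal)) = M.reward s a := by
    refine le_antisymm ((iInf_le _ ⟨0, le_rfl⟩).trans (by simp [lagrangian])) (le_iInf fun l => ?_)
    refine EReal.coe_le_coe_iff.2 ?_
    exact le_add_of_nonneg_right (Finset.sum_nonneg fun j _ => mul_nonneg (l.2 j) (h j))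
  rw [truncReward, this, max_eq_right (EReal.coe_le_coe_iff.2 hC), EReal.toReal_coe]

/-- Off the admissible pairs, a large multiplier of a violated constraint pushes the Lagrangian
below the truncation level. -/
lemma truncReward_of_not_admissible {s : S} {a : A} {C : ℝ} (h : ¬ M.Admissible s a)
    (hC : -C ≤ M.reward s a) : M.truncReward C s a = -C := by
  simp only [Admissible, not_forall, not_le] at h
  obtain ⟨j, hj⟩ := h
  have hle : (⨅ l : {l : Fin J → ℝ // 0 ≤ l}, (M.lagrangian s a l.1 : EReal)) ≤
      ((-C : ℝ) : EReal) := by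
    -- The multiplier `(r + C) / (-r^j)` of the violated constraint makes the Lagrangian `-C`.
    have ht : 0 ≤ (M.reward s a + C) / (-M.constr j s a) :=
      div_nonneg (by linarith) (by linarith)
    refine (iInf_le _ ⟨Pi.single j ((M.reward s a + C) / (-M.constr j s a)),
      Pi.single_nonneg.2 ht⟩).trans (EReal.coe_le_coe_iff.2 (le_of_eq ?_))
    simp only [lagrangian, Pi.single_apply, ite_mul, zero_mul, Finset.sum_ite_eq',
      Finset.mem_univ, if_true]
    field_simp [hj.ne]
    ring
  rw [truncReward, max_eq_left hle, EReal.toReal_coe]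

variable (M) [Fintype S] [Fintype A]

/-- The right-hand side `R(s, a) + γ E[max_a' Q(s₊, a')]` of the Bellman equation, as an operator
on tables. The maximum over policies is replaced by the maximum over actions. -/
noncomputable def bellmanOp (R : S → A → ℝ) (γ : ℝ) (Q : S → A → ℝ) (s : S) (a : A) : ℝ :=
  R s a + γ * pmfExp (M.transition s a) fun s' => ⨆ a', Q s' a'

variable [Nonempty A]

lemma isBellmanSolution_iff {γ C : ℝ} {Q : S → A → ℝ} :
    M.IsBellmanSolution γ C Q ↔ M.bellmanOp (M.truncReward C) γ Q = Q := by
  have hmax : ∀ s a, IsGreatest (Set.range fun π : Policy S A =>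
      pmfExp (M.transition s a) fun s' => pmfExp (π s') (Q s'))
      (pmfExp (M.transition s a) fun s' => ⨆ a', Q s' a') := by
    intro s a
    obtain ⟨π, hπ⟩ := exists_policy_pmfExp_eq_iSup Q
    refine ⟨⟨π, pmfExp_congr _ fun s' _ => hπ s'⟩, ?_⟩
    rintro _ ⟨π', rfl⟩
    exact pmfExp_mono _ fun s' _ => pmfExp_le_iSup _ _
  constructor
  · intro h
    funext s a
    obtain ⟨v, hv, hQ⟩ := h s a
    rw [hQ, hv.unique (hmax s a), bellmanOp]
  · intro h s a
    exact ⟨_, hmax s a, (congrFun (congrFun h s) a).symm⟩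

lemma abs_bellmanOp_sub_le {γ : ℝ} (hγ : 0 ≤ γ) (R : S → A → ℝ) {Q Q' : S → A → ℝ} {b : ℝ}
    (h : ∀ s a, |Q s a - Q' s a| ≤ b) (s : S) (a : A) :
    |M.bellmanOp R γ Q s a - M.bellmanOp R γ Q' s a| ≤ γ * b := by
  rw [bellmanOp, bellmanOp, add_sub_add_left_eq_sub, ← mul_sub, pmfExp_sub, abs_mul,
    abs_of_nonneg hγ]
  exact mul_le_mul_of_nonneg_left (abs_pmfExp_le _ fun s' => abs_iSup_sub_iSup_le (h s')) hγ

lemma contractingWith_bellmanOp {γ : ℝ} (hγ0 : 0 ≤ γ) (hγ1 : γ < 1) (R : S → A → ℝ) :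
    ContractingWith ⟨γ, hγ0⟩ (M.bellmanOp R γ) := by
  refine ⟨by exact_mod_cast hγ1, LipschitzWith.of_dist_le_mul fun Q Q' => ?_⟩
  have hb : 0 ≤ γ * dist Q Q' := mul_nonneg hγ0 dist_nonneg
  refine (dist_pi_le_iff hb).2 fun s => (dist_pi_le_iff hb).2 fun a => ?_
  rw [Real.dist_eq]
  refine M.abs_bellmanOp_sub_le hγ0 R (fun s a => ?_) s a
  rw [← Real.dist_eq]
  exact (dist_le_pi_dist (Q s) (Q' s) a).trans (dist_le_pi_dist Q Q' s)

end PeakMDP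

/-! ### Optimality of greedy policies -/

namespace PeakMDP

section Sign

variable {S A : Type*} {J : ℕ} (M : PeakMDP S A J) [Fintype S] [Fintype A]
  {R Q : S → A → ℝ} {γ : ℝ}

/-- At a state minimizing `max_a Q(s, a)`, with minimum `m`, an action of positive reward gives
`m > γ m`, so `m > 0`. -/
lemma iSup_nonneg_of_bellmanOp_eq (hγ0 : 0 ≤ γ) (hγ1 : γ < 1) (hR : ∀ s, ∃ a, 0 < R s a)
    (hQ : M.bellmanOp R γ Q = Q) (s : S) : 0 ≤ ⨆ a, Q s a := by
  have : Nonempty S := ⟨s⟩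
  obtain ⟨t, ht⟩ := Finite.exists_min fun s => ⨆ a, Q s a
  obtain ⟨b, hb⟩ := hR t
  have h1 := pmfExp_mono (M.transition t b) fun s' _ => ht s'
  rw [pmfExp_const] at h1
  have h2 : Q t b = R t b + γ * pmfExp (M.transition t b) fun s' => ⨆ a', Q s' a' :=
    (congrFun (congrFun hQ t) b).symm
  have h3 := mul_le_mul_of_nonneg_left h1 hγ0
  have h4 := le_iSup_of_fintype (Q t) b
  exact le_trans (by nlinarith) (ht s)

variable [Nonempty A]

/-- At a state maximizing `max_a Q(s, a)`, with maximum `m`, the Bellman equation gives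
`m ≤ c + γ m`. -/
lemma iSup_le_of_bellmanOp_eq (hγ0 : 0 ≤ γ) (hγ1 : γ < 1) {c : ℝ} (hR : ∀ s a, R s a ≤ c)
    (hQ : M.bellmanOp R γ Q = Q) (s : S) : ⨆ a, Q s a ≤ c / (1 - γ) := by
  have : Nonempty S := ⟨s⟩
  obtain ⟨t, ht⟩ := exists_eq_ciSup_of_finite (f := fun s => ⨆ a, Q s a)
  obtain ⟨b, hb⟩ := exists_eq_ciSup_of_finite (f := Q t)
  have hs := le_iSup_of_fintype (fun s => ⨆ a, Q s a) s
  have h1 := pmfExp_le_iSup (M.transition t b) (fun s => ⨆ a, Q s a)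
  have h2 : Q t b = R t b + γ * pmfExp (M.transition t b) fun s' => ⨆ a', Q s' a' :=
    (congrFun (congrFun hQ t) b).symm
  have h3 := mul_le_mul_of_nonneg_left h1 hγ0
  have h4 := hR t b
  rw [le_div_iff₀ (by linarith)]
  nlinarith

/-- Truncation at `-C` with `C = cγ / (1 - γ)` is just low enough: a penalized first step cannot be
compensated by the largest possible later reward, while an admissible one has a positive value. -/
lemma admissible_of_eq_iSup {c C : ℝ} (hγ0 : 0 < γ) (hγ1 : γ < 1) (hC : C = c * γ / (1 - γ))
    (hr : ∀ s a, |M.reward s a| ≤ c) (hpos : ∀ s a, 0 < M.reward s a)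
    (hadm : ∀ s, ∃ a, M.Admissible s a)
    (hQ : M.bellmanOp (M.truncReward C) γ Q = Q) {s : S} {a : A} (ha : Q s a = ⨆ b, Q s b) :
    M.Admissible s a := by
  by_contra hna
  have hc : 0 ≤ c := (abs_nonneg _).trans (hr s a)
  have hC0 : 0 ≤ C := hC ▸ div_nonneg (mul_nonneg hc hγ0.le) (by linarith)
  have hCr : ∀ s a, -C ≤ M.reward s a := fun s a => by linarith [hpos s a]
  have hRle : ∀ s a, M.truncReward C s a ≤ c := by
    intro s a
    by_cases h : M.Admissible s a
    · exact truncReward_of_admissible h (hCr s a) ▸ (le_abs_self _).trans (hr s a)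
    · rw [truncReward_of_not_admissible h (hCr s a)]
      linarith
  have hRpos : ∀ s, ∃ a, 0 < M.truncReward C s a := fun s => by
    obtain ⟨b, hb⟩ := hadm s
    exact ⟨b, truncReward_of_admissible hb (hCr s b) ▸ hpos s b⟩
  have eqn : ∀ b, Q s b = M.truncReward C s b +
      γ * pmfExp (M.transition s b) fun s' => ⨆ a', Q s' a' :=
    fun b => (congrFun (congrFun hQ s) b).symm
  have hup := pmfExp_mono (M.transition s a) fun s' _ =>
    M.iSup_le_of_bellmanOp_eq hγ0.le hγ1 hRle hQ s'
  rw [pmfExp_const] at hup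
  obtain ⟨b, hb⟩ := hadm s
  have hlow := pmfExp_mono (M.transition s b) fun s' _ =>
    M.iSup_nonneg_of_bellmanOp_eq hγ0.le hγ1 hRpos hQ s'
  rw [pmfExp_const] at hlow
  have h1 := mul_le_mul_of_nonneg_left hup hγ0.le
  have h2 := mul_nonneg hγ0.le hlow
  have h3 : γ * (c / (1 - γ)) = C := by rw [hC]; ring
  have h4 := eqn a
  have h5 := eqn b
  have h6 := le_iSup_of_fintype (Q s) b
  rw [truncReward_of_not_admissible hna (hCr s a)] at h4
  rw [truncReward_of_admissible hb (hCr s b)] at h5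
  linarith [hpos s b]

end Sign

section Trajectory

variable {S A : Type*} {J : ℕ} (M : PeakMDP S A J) [Fintype S] [Fintype A]

/-- Expectation of `f` at the next state-action pair, when `π` chooses the next action. -/
noncomputable def nextExp (π : Policy S A) (f : S × A → ℝ) (x : S × A) : ℝ :=
  pmfExp (M.transition x.1 x.2) fun s' => pmfExp (π s') fun a' => f (s', a')

variable [MeasurableSpace S] [MeasurableSingletonClass S]
  [MeasurableSpace A] [MeasurableSingletonClass A] (π : Policy S A) (s : S)

instance isProbabilityMeasure_trajLaw : IsProbabilityMeasure (M.trajLaw π s) := by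
  have : IsProbabilityMeasure ((π s).map fun a => (s, a)).toMeasure :=
    PMF.toMeasure.isProbabilityMeasure _
  unfold trajLaw
  infer_instance

lemma map_trajLaw_zero :
    (M.trajLaw π s).map (fun ω => ω 0) = ((π s).map fun a => (s, a)).toMeasure := by
  have h0 : (fun ω : ℕ → S × A => ω 0) =
      (fun x : (_ : Finset.Iic 0) → S × A => x ⟨0, Finset.mem_Iic.2 le_rfl⟩) ∘
        Preorder.frestrictLe (π := fun _ => S × A) 0 := rfl
  have h1 : (M.trajLaw π s).map (Preorder.frestrictLe (π := fun _ => S × A) 0) =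
      (((π s).map fun a => (s, a)).toMeasure).map
        (MeasurableEquiv.piUnique (fun _ : Finset.Iic 0 => S × A)).symm := by
    rw [trajLaw, Kernel.trajMeasure, Measure.map_comp _ _ (by fun_prop),
      Kernel.traj_map_frestrictLe, Kernel.partialTraj_self, Measure.id_comp]
  rw [h0, ← Measure.map_map (by fun_prop) (by fun_prop), h1,
    Measure.map_map (by fun_prop) (by fun_prop)]
  exact Measure.map_id

lemma integrable_comp_trajLaw (f : S × A → ℝ) (n : ℕ) :
    Integrable (fun ω => f (ω n)) (M.trajLaw π s) := by
  have hp : IsProbabilityMeasure ((M.trajLaw π s).map fun ω => ω n) :=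
    Measure.isProbabilityMeasure_map (measurable_pi_apply n).aemeasurable
  exact (Integrable.of_finite (f := f)).comp_measurable (measurable_pi_apply n)

lemma integral_trajLaw_zero (f : S × A → ℝ) :
    ∫ ω, f (ω 0) ∂(M.trajLaw π s) = pmfExp (π s) fun a => f (s, a) := by
  classical
  rw [← integral_map (φ := fun ω : ℕ → S × A => ω 0)
    (measurable_pi_apply 0).aemeasurable
    (measurable_of_countable f).aestronglyMeasurable, map_trajLaw_zero,
    ← PMF.toMeasure_map _ _ (measurable_of_countable _),
    integral_map (measurable_of_countable _).aemeasurable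
      (measurable_of_countable f).aestronglyMeasurable, PMF.integral_eq_sum]
  simp [pmfExp]

lemma integral_stepKernel (f : S × A → ℝ) (n : ℕ) (h : (_ : Finset.Iic n) → S × A) :
    ∫ x, f x ∂(M.stepKernel π n h) = M.nextExp π f (h ⟨n, Finset.mem_Iic.2 le_rfl⟩) := by
  classical
  change ∫ x, f x ∂(PMF.toMeasure _) = _
  rw [PMF.integral_eq_sum, Fintype.sum_prod_type]
  simp only [nextExp, pmfExp, Finset.mul_sum]
  refine Finset.sum_congr rfl fun s' _ => Finset.sum_congr rfl fun a' _ => ?_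
  rw [smul_eq_mul, ← mul_assoc, ← ENNReal.toReal_mul]
  congr 2
  rw [PMF.bind_apply, tsum_eq_single s']
  · rw [PMF.map_apply, tsum_eq_single a']
    · simp
    · intro b hb
      simp [hb.symm]
  · intro t ht
    simp [PMF.map_apply, ht.symm]

/-- Chapman–Kolmogorov in integrated form. -/
lemma integral_trajLaw_succ (f : S × A → ℝ) (n : ℕ) :
    ∫ ω, f (ω (n + 1)) ∂(M.trajLaw π s) = ∫ ω, M.nextExp π f (ω n) ∂(M.trajLaw π s) := by
  have : IsProbabilityMeasure ((π s).map fun a => (s, a)).toMeasure :=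
    PMF.toMeasure.isProbabilityMeasure _
  have key := Kernel.map_frestrictLe_trajMeasure_compProd_eq_map_trajMeasure
    (X := fun _ => S × A) (μ₀ := ((π s).map fun a => (s, a)).toMeasure) (κ := M.stepKernel π)
    (a := n)
  have h1 : ∫ ω, f (ω (n + 1)) ∂(M.trajLaw π s) =
      ∫ x, f x.2 ∂((M.trajLaw π s).map
        fun ω => (Preorder.frestrictLe (π := fun _ => S × A) n ω, ω (n + 1))) := by
    rw [integral_map (by fun_prop) (measurable_of_countable _).aestronglyMeasurable]
  rw [h1, trajLaw, ← key, Measure.integral_compProd Integrable.of_finite]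
  simp only [integral_stepKernel]
  rw [integral_map (by fun_prop) (measurable_of_countable _).aestronglyMeasurable]
  rfl

/-- Almost surely, the policy gives positive probability to every action taken. -/
lemma ae_policy_ne_zero : ∀ᵐ ω ∂(M.trajLaw π s), ∀ k, π (ω k).1 (ω k).2 ≠ 0 := by
  classical
  rw [ae_all_iff]
  intro k
  set f : S × A → ℝ := fun x => if π x.1 x.2 = 0 then 1 else 0 with hf
  have hπ : ∀ s', pmfExp (π s') (fun a' => f (s', a')) = 0 := fun s' => by
    rw [← pmfExp_const (π s') 0]
    exact pmfExp_congr _ fun a ha => by simp [hf, ha]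
  have h0 : ∫ ω, f (ω k) ∂(M.trajLaw π s) = 0 := by
    cases k with
    | zero => rw [integral_trajLaw_zero, hπ]
    | succ n =>
      rw [integral_trajLaw_succ]
      simp [nextExp, hπ, pmfExp_const]
  have hnn : ∀ x, 0 ≤ f x := fun x => by simp only [hf]; split_ifs <;> simp
  filter_upwards [(integral_eq_zero_iff_of_nonneg (fun ω => hnn (ω k))
    (M.integrable_comp_trajLaw π s f k)).1 h0] with ω hω hz
  simp [hf, hz] at hω

variable {M π s}

/-- Under a feasible policy the trajectory visits every state and takes only admissible actions, so
every state has an admissible action. -/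
lemma exists_admissible (hM : M.IsUnichain) (h : M.IsFeasible π s) (s' : S) :
    ∃ a, M.Admissible s' a := by
  obtain ⟨n, hn⟩ := hM π s s'
  by_contra! hna
  refine hn.ne' (measure_mono_null (t := {ω | ¬ ∀ k j, 0 ≤ M.constr j (ω k).1 (ω k).2})
    (fun ω hω hfeas => hna (ω n).2 fun j => ?_) h)
  have hω : (ω n).1 = s' := hω
  exact hω ▸ hfeas n j

lemma IsFeasible.integral_truncReward (h : M.IsFeasible π s) {C : ℝ}
    (hC : ∀ s a, -C ≤ M.reward s a) (k : ℕ) :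
    ∫ ω, M.truncReward C (ω k).1 (ω k).2 ∂(M.trajLaw π s) =
      ∫ ω, M.reward (ω k).1 (ω k).2 ∂(M.trajLaw π s) := by
  refine integral_congr_ae ?_
  filter_upwards [h] with ω hω
  exact truncReward_of_admissible (hω k) (hC _ _)

variable (M π s)

lemma exists_abs_integral_trajLaw_le (f : S × A → ℝ) :
    ∃ b, ∀ n, |∫ ω, f (ω n) ∂(M.trajLaw π s)| ≤ b := by
  obtain ⟨b, hb⟩ := (Set.finite_range fun x : S × A => |f x|).bddAbove
  refine ⟨b, fun n => ?_⟩
  simpa using norm_integral_le_of_norm_le_const (μ := M.trajLaw π s) (f := fun ω => f (ω n))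
    (C := b) (Eventually.of_forall fun ω => hb ⟨ω n, rfl⟩)

lemma summable_discounted {γ : ℝ} (hγ0 : 0 ≤ γ) (hγ1 : γ < 1) (f : S × A → ℝ) :
    Summable fun n => γ ^ n * ∫ ω, f (ω n) ∂(M.trajLaw π s) := by
  obtain ⟨b, hb⟩ := M.exists_abs_integral_trajLaw_le π s f
  refine Summable.of_norm_bounded
    ((summable_geometric_of_lt_one hγ0 hγ1).mul_right b) fun k => ?_
  rw [norm_mul, norm_pow, Real.norm_of_nonneg hγ0]
  exact mul_le_mul_of_nonneg_left (hb k) (pow_nonneg hγ0 k)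

/-- A supersolution `f ≥ ρ + γ P^π f` of the evaluation equation of `π` bounds the discounted sum
of `ρ` from above: the partial sums telescope up to the vanishing term `γ^n E f(s_n, a_n)`. -/
lemma tsum_discounted_le {γ : ℝ} (hγ0 : 0 ≤ γ) (hγ1 : γ < 1) {ρ f : S × A → ℝ}
    (hf : ∀ x, ρ x + γ * M.nextExp π f x ≤ f x) :
    ∑' n, γ ^ n * ∫ ω, ρ (ω n) ∂(M.trajLaw π s) ≤ pmfExp (π s) fun a => f (s, a) := by
  set q : ℕ → ℝ := fun n => ∫ ω, f (ω n) ∂(M.trajLaw π s) with hq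
  have hstep : ∀ n, ∫ ω, ρ (ω n) ∂(M.trajLaw π s) + γ * q (n + 1) ≤ q n := by
    intro n
    have hi := (M.integrable_comp_trajLaw π s (M.nextExp π f) n).const_mul γ
    simp only [hq]
    rw [M.integral_trajLaw_succ π s f n, ← integral_const_mul,
      ← integral_add (M.integrable_comp_trajLaw π s ρ n) hi]
    exact integral_mono ((M.integrable_comp_trajLaw π s ρ n).add hi)
      (M.integrable_comp_trajLaw π s f n) fun ω => hf (ω n)
  have hsum : ∀ n, ∑ k ∈ Finset.range n, γ ^ k * ∫ ω, ρ (ω k) ∂(M.trajLaw π s)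
      ≤ q 0 - γ ^ n * q n := by
    intro n
    induction n with
    | zero => simp
    | succ n ih =>
      rw [Finset.sum_range_succ, pow_succ]
      nlinarith [mul_le_mul_of_nonneg_left (hstep n) (pow_nonneg hγ0 n)]
  have hlim := (tendsto_const_nhds (x := q 0)).sub
    (M.summable_discounted π s hγ0 hγ1 f).tendsto_atTop_zero
  rw [sub_zero] at hlim
  rw [← M.integral_trajLaw_zero π s f]
  exact le_of_tendsto_of_tendsto'
    (M.summable_discounted π s hγ0 hγ1 ρ).hasSum.tendsto_sum_nat hlim hsum

lemma le_tsum_discounted {γ : ℝ} (hγ0 : 0 ≤ γ) (hγ1 : γ < 1) {ρ f : S × A → ℝ}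
    (hf : ∀ x, f x ≤ ρ x + γ * M.nextExp π f x) :
    pmfExp (π s) (fun a => f (s, a)) ≤ ∑' n, γ ^ n * ∫ ω, ρ (ω n) ∂(M.trajLaw π s) := by
  have h := M.tsum_discounted_le π s hγ0 hγ1 (ρ := fun x => -ρ x) (f := fun x => -f x) fun x => by
    have : M.nextExp π (fun x => -f x) x = -M.nextExp π f x := by simp [nextExp, pmfExp]
    rw [this]
    linarith [hf x]
  simp only [integral_neg, mul_neg, tsum_neg, pmfExp, Finset.sum_neg_distrib] at h
  exact neg_le_neg_iff.1 h

variable {M π s}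

lemma IsFeasible.value_eq_tsum (h : M.IsFeasible π s) {γ C : ℝ}
    (hC : ∀ s a, -C ≤ M.reward s a) : M.value γ π s =
      ∑' n, γ ^ n * ∫ ω, M.truncReward C (ω n).1 (ω n).2 ∂(M.trajLaw π s) :=
  tsum_congr fun k => by rw [h.integral_truncReward hC k]

variable {γ c C : ℝ} {Q : S → A → ℝ}

lemma IsFeasible.value_le (h : M.IsFeasible π s) (hγ0 : 0 ≤ γ) (hγ1 : γ < 1)
    (hC : ∀ s a, -C ≤ M.reward s a)
    (hQ : M.bellmanOp (M.truncReward C) γ Q = Q) : M.value γ π s ≤ ⨆ a, Q s a := by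
  rw [h.value_eq_tsum hC]
  refine (M.tsum_discounted_le π s hγ0 hγ1 (ρ := fun x => M.truncReward C x.1 x.2)
    (f := fun x => Q x.1 x.2) fun x => ?_).trans (pmfExp_le_iSup _ _)
  refine le_trans ?_ (congrFun (congrFun hQ x.1) x.2).le
  exact add_le_add_right (mul_le_mul_of_nonneg_left
    (pmfExp_mono _ fun s' _ => pmfExp_le_iSup _ _) hγ0) _

variable [Nonempty A]

lemma IsFeasible.le_value_of_isGreedy (h : M.IsFeasible π s) (hπ : IsGreedy Q π) (hγ0 : 0 ≤ γ)
    (hγ1 : γ < 1) (hC : ∀ s a, -C ≤ M.reward s a)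
    (hQ : M.bellmanOp (M.truncReward C) γ Q = Q) : ⨆ a, Q s a ≤ M.value γ π s := by
  rw [h.value_eq_tsum hC, ← hπ.pmfExp_eq_iSup s]
  refine M.le_tsum_discounted π s hγ0 hγ1 (ρ := fun x => M.truncReward C x.1 x.2)
    (f := fun x => Q x.1 x.2) fun x => ?_
  refine (congrFun (congrFun hQ x.1) x.2).ge.trans (le_of_eq ?_)
  simp only [bellmanOp, nextExp, hπ.pmfExp_eq_iSup]

lemma isOptimal_of_isGreedy (hγ0 : 0 < γ) (hγ1 : γ < 1) (hr : ∀ s a, |M.reward s a| ≤ c)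
    (hpos : ∀ s a, 0 < M.reward s a) (hadm : ∀ s, ∃ a, M.Admissible s a)
    (hC : C = c * γ / (1 - γ)) (hQ : M.bellmanOp (M.truncReward C) γ Q = Q)
    (hπ : IsGreedy Q π) : M.IsOptimal γ π s := by
  have hCr : ∀ s a, -C ≤ M.reward s a := fun s a => by
    have hC0 : 0 ≤ C := hC ▸ div_nonneg
      (mul_nonneg ((abs_nonneg _).trans (hr s a)) hγ0.le) (by linarith)
    linarith [hpos s a]
  have hfeas : M.IsFeasible π s := by
    filter_upwards [M.ae_policy_ne_zero π s] with ω hω k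
    exact M.admissible_of_eq_iSup hγ0 hγ1 hC hr hpos hadm hQ
      (eq_iSup_of_pmfExp_eq (hπ.pmfExp_eq_iSup _) (hω k))
  refine ⟨hfeas, fun π' hπ' => ?_⟩
  exact (hπ'.value_le hγ0.le hγ1 hCr hQ).trans
    (hfeas.le_value_of_isGreedy hπ hγ0.le hγ1 hCr hQ)

end Trajectory

end PeakMDP

/-! ### Sums of martingale differences -/

section MartingaleDifference

variable {Ω : Type*} {mΩ : MeasurableSpace Ω} {μ : Measure Ω} [IsProbabilityMeasure μ]
  {ℱ : Filtration ℕ mΩ}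

/-- The martingale transform of bounded martingale differences by square-summable predictable
weights converges when the sum of squares is bounded by a constant: it is bounded in `L²`. -/
lemma ae_tendsto_sum_mul_of_sum_sq_le {ξ w : ℕ → Ω → ℝ} {N : ℝ}
    (hξm : ∀ k, Measurable[ℱ (k + 1)] (ξ k)) (hξb : ∀ k ω, |ξ k ω| ≤ 1)
    (hξ0 : ∀ k, μ[ξ k | ℱ k] =ᵐ[μ] 0) (hwm : ∀ k, Measurable[ℱ k] (w k))
    (hwN : ∀ n ω, ∑ k ∈ Finset.range n, w k ω ^ 2 ≤ N) :
    ∀ᵐ ω ∂μ, ∃ l, Tendsto (fun n => ∑ k ∈ Finset.range n, w k ω * ξ k ω) atTop (𝓝 l) := by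
  set f : ℕ → Ω → ℝ := fun n ω => ∑ k ∈ Finset.range n, w k ω * ξ k ω with hf
  have hwb : ∀ k ω, |w k ω| ≤ 1 + N := fun k ω => by
    have h1 : w k ω ^ 2 ≤ N := (Finset.single_le_sum (f := fun k => w k ω ^ 2)
      (fun _ _ => sq_nonneg _) (Finset.self_mem_range_succ k)).trans (hwN (k + 1) ω)
    rw [abs_le]
    constructor <;> nlinarith [sq_nonneg (w k ω - 1), sq_nonneg (w k ω + 1)]
  have hstep : ∀ k ω, |w k ω * ξ k ω| ≤ 1 + N := fun k ω => by
    rw [abs_mul]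
    nlinarith [hwb k ω, hξb k ω, abs_nonneg (w k ω), abs_nonneg (ξ k ω)]
  have hfb : ∀ n ω, |f n ω| ≤ n * (1 + N) := fun n ω => by
    refine (Finset.abs_sum_le_sum_abs _ _).trans ((Finset.sum_le_sum fun k _ => hstep k ω).trans ?_)
    rw [Finset.sum_const, Finset.card_range, nsmul_eq_mul]
  have hfm : ∀ n, Measurable[ℱ n] (f n) := fun n =>
    Finset.measurable_fun_sum _ fun k hk =>
      ((hwm k).mono (ℱ.mono (Finset.mem_range.1 hk).le) le_rfl).mul
        ((hξm k).mono (ℱ.mono (Finset.mem_range.1 hk)) le_rfl)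
  have hint : ∀ {g : Ω → ℝ} {b : ℝ}, Measurable g → (∀ ω, |g ω| ≤ b) → Integrable g μ :=
    fun hg hb => Integrable.of_bound hg.aestronglyMeasurable _ (Eventually.of_forall hb)
  have hξi : ∀ k, Integrable (ξ k) μ := fun k => hint ((hξm k).mono (ℱ.le _) le_rfl) (hξb k)
  -- Bounded weights known at time `k` keep the increments centred.
  have hpull : ∀ k {g : Ω → ℝ} {b : ℝ}, Measurable[ℱ k] g → (∀ ω, |g ω| ≤ b) →
      μ[fun ω => g ω * ξ k ω | ℱ k] =ᵐ[μ] 0 := by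
    intro k g b hg hb
    have hgi : Integrable (g * ξ k) μ :=
      (hξi k).bdd_mul (hg.mono (ℱ.le k) le_rfl).aestronglyMeasurable (Eventually.of_forall hb)
    have := condExp_mul_of_stronglyMeasurable_left (μ := μ) hg.stronglyMeasurable hgi (hξi k)
    filter_upwards [this, hξ0 k] with ω h1 h2
    change (μ[g * ξ k | ℱ k]) ω = 0
    rw [h1, Pi.mul_apply, h2, Pi.zero_apply, mul_zero]
  have hfi : ∀ n, Integrable (f n) μ := fun n => hint ((hfm n).mono (ℱ.le n) le_rfl) (hfb n)
  have hmart : Martingale f ℱ μ := by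
    refine martingale_of_condExp_sub_eq_zero_nat (fun n => (hfm n).stronglyMeasurable) hfi
      fun n => ?_
    have : f (n + 1) - f n = fun ω => w n ω * ξ n ω := by
      funext ω
      simp [hf, Finset.sum_range_succ]
    rw [this]
    exact hpull n (hwm n) (hwb n)
  have hwsm : ∀ n, Measurable fun ω => ∑ k ∈ Finset.range n, w k ω ^ 2 := fun n =>
    Finset.measurable_fun_sum _ fun k _ => ((hwm k).mono (ℱ.le k) le_rfl).pow_const 2
  have hwsi : ∀ n, Integrable (fun ω => ∑ k ∈ Finset.range n, w k ω ^ 2) μ := fun n =>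
    hint (b := N) (hwsm n) fun ω => by
      rw [abs_of_nonneg (Finset.sum_nonneg fun _ _ => sq_nonneg _)]
      exact hwN n ω
  have hf2i : ∀ n, Integrable (fun ω => f n ω ^ 2) μ := fun n =>
    hint (b := (n * (1 + N)) ^ 2) (((hfm n).mono (ℱ.le n) le_rfl).pow_const 2) fun ω => by
      rw [abs_pow]
      exact pow_le_pow_left₀ (abs_nonneg _) (hfb n ω) 2
  -- Orthogonality of the increments.
  have hL2 : ∀ n, ∫ ω, f n ω ^ 2 ∂μ ≤ ∫ ω, ∑ k ∈ Finset.range n, w k ω ^ 2 ∂μ := by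
    intro n
    induction n with
    | zero => simp [hf]
    | succ n ih =>
      have hgm : Measurable[ℱ n] fun ω => 2 * f n ω * w n ω :=
        ((hfm n).const_mul 2).mul (hwm n)
      have hgb : ∀ ω, |2 * f n ω * w n ω| ≤ 2 * (n * (1 + N)) * (1 + N) := fun ω => by
        rw [abs_mul, abs_mul, abs_two]
        exact mul_le_mul (mul_le_mul_of_nonneg_left (hfb n ω) zero_le_two) (hwb n ω)
          (abs_nonneg _) (mul_nonneg zero_le_two ((abs_nonneg _).trans (hfb n ω)))
      have hgi : Integrable (fun ω => 2 * f n ω * w n ω * ξ n ω) μ :=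
        (hξi n).bdd_mul (hgm.mono (ℱ.le n) le_rfl).aestronglyMeasurable (Eventually.of_forall hgb)
      have hcross : ∫ ω, 2 * f n ω * w n ω * ξ n ω ∂μ = 0 := by
        rw [← integral_condExp (ℱ.le n), integral_congr_ae (hpull n hgm hgb)]
        simp
      have hwi : Integrable (fun ω => w n ω ^ 2) μ := by
        refine ((hwsi (n + 1)).sub (hwsi n)).congr (Eventually.of_forall fun ω => ?_)
        simp [Finset.sum_range_succ]
      calc ∫ ω, f (n + 1) ω ^ 2 ∂μ
          ≤ ∫ ω, (f n ω ^ 2 + 2 * f n ω * w n ω * ξ n ω + w n ω ^ 2) ∂μ := by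
            refine integral_mono (hf2i _) (((hf2i n).add hgi).add hwi) fun ω => ?_
            have h1 : f (n + 1) ω = f n ω + w n ω * ξ n ω := by
              simp [hf, Finset.sum_range_succ]
            have h2 : ξ n ω ^ 2 ≤ 1 := (sq_le_one_iff_abs_le_one _).2 (hξb n ω)
            simp only [h1]
            nlinarith [mul_le_mul_of_nonneg_left h2 (sq_nonneg (w n ω))]
        _ = ∫ ω, f n ω ^ 2 ∂μ + ∫ ω, w n ω ^ 2 ∂μ := by
            rw [integral_add (f := fun ω => f n ω ^ 2 + 2 * f n ω * w n ω * ξ n ω)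
              ((hf2i n).add hgi) hwi, integral_add (hf2i n) hgi, hcross, add_zero]
        _ ≤ _ := by
            simp only [Finset.sum_range_succ]
            rw [integral_add (hwsi n) hwi]
            exact add_le_add_left ih _
  have hL1 : ∀ n, eLpNorm (f n) 1 μ ≤ ((1 + N).toNNReal : ENNReal) := by
    intro n
    rw [eLpNorm_one_eq_lintegral_enorm, ← ofReal_integral_norm_eq_lintegral_enorm (hfi n)]
    refine ENNReal.ofReal_le_ofReal ?_
    calc ∫ ω, ‖f n ω‖ ∂μ ≤ ∫ ω, (1 + f n ω ^ 2) ∂μ := by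
          refine integral_mono (hfi n).norm ((integrable_const 1).add (hf2i n)) fun ω => ?_
          simp only [Real.norm_eq_abs]
          nlinarith [sq_nonneg (|f n ω| - 1), sq_abs (f n ω)]
      _ = 1 + ∫ ω, f n ω ^ 2 ∂μ := by rw [integral_add (integrable_const 1) (hf2i n)]; simp
      _ ≤ 1 + ∫ _, N ∂μ := by
          exact add_le_add_right
            ((hL2 n).trans (integral_mono (hwsi n) (integrable_const N) (hwN n))) _
      _ = 1 + N := by simp
  exact hmart.submartingale.exists_ae_tendsto_of_bdd hL1

/-- The same under almost sure square-summability only, by localization: the weights are cut off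
as soon as their sum of squares exceeds `N`, and almost every path is unaffected for large `N`. -/
lemma ae_tendsto_sum_mul_of_summable_sq {ξ w : ℕ → Ω → ℝ}
    (hξm : ∀ k, Measurable[ℱ (k + 1)] (ξ k)) (hξb : ∀ k ω, |ξ k ω| ≤ 1)
    (hξ0 : ∀ k, μ[ξ k | ℱ k] =ᵐ[μ] 0) (hwm : ∀ k, Measurable[ℱ k] (w k))
    (hw : ∀ᵐ ω ∂μ, Summable fun k => w k ω ^ 2) :
    ∀ᵐ ω ∂μ, ∃ l, Tendsto (fun n => ∑ k ∈ Finset.range n, w k ω * ξ k ω) atTop (𝓝 l) := by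
  classical
  set v : ℕ → ℕ → Ω → ℝ := fun N k ω =>
    if ∑ i ∈ Finset.range (k + 1), w i ω ^ 2 ≤ N then w k ω else 0 with hv
  have hvm : ∀ N k, Measurable[ℱ k] (v N k) := fun N k => by
    refine Measurable.ite (measurableSet_le (Finset.measurable_fun_sum _ fun i hi => ?_)
      measurable_const) (hwm k) measurable_const
    exact ((hwm i).mono (ℱ.mono (Nat.lt_succ_iff.1 (Finset.mem_range.1 hi))) le_rfl).pow_const 2
  have hvN : ∀ N n ω, ∑ k ∈ Finset.range n, v N k ω ^ 2 ≤ N := by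
    intro N n ω
    induction n with
    | zero => simp
    | succ n ih =>
      by_cases h : ∑ i ∈ Finset.range (n + 1), w i ω ^ 2 ≤ N
      · refine le_trans (Finset.sum_le_sum fun k _ => ?_) h
        simp only [hv]
        split_ifs
        · exact le_rfl
        · simpa using sq_nonneg (w k ω)
      · rw [Finset.sum_range_succ]
        simpa [hv, h] using ih
  have hconv := ae_all_iff.2 fun N : ℕ =>
    ae_tendsto_sum_mul_of_sum_sq_le (μ := μ) hξm hξb hξ0 (hvm N) (hvN N)
  filter_upwards [hw, hconv] with ω hω hl
  obtain ⟨N, hN⟩ := exists_nat_ge (∑' k, w k ω ^ 2)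
  obtain ⟨l, hl⟩ := hl N
  refine ⟨l, hl.congr fun n => Finset.sum_congr rfl fun k _ => ?_⟩
  simp [hv, (hω.sum_le_tsum _ fun _ _ => sq_nonneg _).trans hN]

end MartingaleDifference

/-! ### Deterministic asynchronous contractions -/

/-- A sequence relaxed towards values below `b`, with steps of infinite total size, is eventually
below any number above `b`: its excess over `b` is multiplied by `∏ (1 - α k) → 0`. -/
lemma eventually_le_of_relaxation {x α : ℕ → ℝ} {b b' : ℝ} (hbb : b < b')
    (hα1 : ∀ k, α k ≤ 1) (hα : Tendsto (fun n => ∑ k ∈ Finset.range n, α k) atTop atTop)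
    (hx : ∀ᶠ k in atTop, x (k + 1) ≤ (1 - α k) * x k + α k * b) :
    ∀ᶠ k in atTop, x k ≤ b' := by
  obtain ⟨K, hK⟩ := eventually_atTop.1 hx
  set D := max (x K - b) 0
  have hbound : ∀ n, x (K + n) - b ≤ D * Real.exp (-∑ k ∈ Finset.range n, α (K + k)) := by
    intro n
    induction n with
    | zero => simp [D]
    | succ n ih =>
      have h1 := hK (K + n) (Nat.le_add_right _ _)
      have h2 : 1 - α (K + n) ≤ Real.exp (-α (K + n)) := by
        linarith [Real.add_one_le_exp (-α (K + n))]
      have hD : 0 ≤ D * Real.exp (-∑ k ∈ Finset.range n, α (K + k)) := by positivity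
      rw [Finset.sum_range_succ, neg_add, Real.exp_add, ← mul_assoc, ← add_assoc]
      calc x (K + n + 1) - b ≤ (1 - α (K + n)) * (x (K + n) - b) := by linarith
        _ ≤ (1 - α (K + n)) * (D * Real.exp (-∑ k ∈ Finset.range n, α (K + k))) :=
            mul_le_mul_of_nonneg_left ih (by linarith [hα1 (K + n)])
        _ ≤ Real.exp (-α (K + n)) * (D * Real.exp (-∑ k ∈ Finset.range n, α (K + k))) :=
            mul_le_mul_of_nonneg_right h2 hD
        _ = _ := mul_comm _ _
  have hsum : Tendsto (fun n => ∑ k ∈ Finset.range n, α (K + k)) atTop atTop := by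
    have h1 := (tendsto_add_atTop_iff_nat K).2 hα
    have h2 := tendsto_atTop_add_const_right atTop (-∑ k ∈ Finset.range K, α k) h1
    refine h2.congr fun n => ?_
    rw [add_comm n K, Finset.sum_range_add]
    ring
  have hlim : Tendsto (fun n => D * Real.exp (-∑ k ∈ Finset.range n, α (K + k))) atTop (𝓝 0) := by
    simpa using (Real.tendsto_exp_neg_atTop_nhds_zero.comp hsum).const_mul D
  obtain ⟨N, hN⟩ := eventually_atTop.1 (hlim.eventually_lt_const (sub_pos.2 hbb))
  refine eventually_atTop.2 ⟨K + N, fun k hk => ?_⟩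
  obtain ⟨n, rfl⟩ := Nat.exists_eq_add_of_le (show K ≤ k by lia)
  linarith [hbound n, hN n (by lia)]

/-- An asynchronous iteration whose updates contract the sup norm by `γ < 1`, up to vanishing
errors, tends to zero: an eventual bound `b` improves to any bound above `γ b`. -/
lemma tendsto_zero_of_asynchronous_contraction {I : Type*} [Finite I] {Y α : ℕ → I → ℝ}
    {ε : ℕ → ℝ} {γ B : ℝ} (hγ0 : 0 ≤ γ) (hγ1 : γ < 1) (hε : Tendsto ε atTop (𝓝 0))
    (hB : ∀ k i, |Y k i| ≤ B) (hα0 : ∀ k i, 0 ≤ α k i) (hα1 : ∀ k i, α k i ≤ 1)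
    (hα : ∀ i, Tendsto (fun n => ∑ k ∈ Finset.range n, α k i) atTop atTop)
    (hY : ∀ k i b, (∀ j, |Y k j| ≤ b) →
      |Y (k + 1) i| ≤ (1 - α k i) * |Y k i| + α k i * (γ * b + ε k)) (i : I) :
    Tendsto (fun k => Y k i) atTop (𝓝 0) := by
  have himprove : ∀ b b', γ * b < b' → (∀ᶠ k in atTop, ∀ j, |Y k j| ≤ b) →
      ∀ᶠ k in atTop, ∀ j, |Y k j| ≤ b' := by
    intro b b' hbb h
    refine eventually_all.2 fun j => ?_
    have hδ : 0 < (b' - γ * b) / 2 := by linarith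
    refine eventually_le_of_relaxation (b := γ * b + (b' - γ * b) / 2) (by linarith)
      (fun k => hα1 k j) (hα j) ?_
    filter_upwards [h, hε.eventually_lt_const hδ] with k hk hεk
    refine (hY k j b hk).trans ?_
    gcongr
    exact hα0 k j
  -- `θ` lies strictly between `γ` and `1`, which leaves room for the errors at each improvement.
  set θ := (1 + γ) / 2 with hθ
  have hpow : ∀ m : ℕ, ∀ᶠ k in atTop, ∀ j, |Y k j| ≤ θ ^ m * max B 1 := by
    intro m
    induction m with
    | zero => exact Eventually.of_forall fun k j => by simp [hB k j]
    | succ m ih =>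
      refine himprove _ _ ?_ ih
      have h1 : 0 < θ ^ m * max B 1 :=
        mul_pos (pow_pos (by linarith) m) (lt_of_lt_of_le one_pos (le_max_right _ _))
      rw [pow_succ]
      nlinarith
  have hlim : Tendsto (fun m : ℕ => θ ^ m * max B 1) atTop (𝓝 0) := by
    simpa using (tendsto_pow_atTop_nhds_zero_of_lt_one (by linarith : 0 ≤ θ)
      (by linarith)).mul_const (max B 1)
  rw [Metric.tendsto_nhds]
  intro δ hδ
  obtain ⟨m, hm⟩ := (hlim.eventually_lt_const hδ).exists
  filter_upwards [hpow m] with k hk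
  rw [Real.dist_eq, sub_zero]
  exact (hk i).trans_lt hm

/-! ### Convergence of Q-learning -/

namespace PeakMDP

variable {S A : Type*} {J : ℕ} (M : PeakMDP S A J) [Fintype S] [Fintype A] [Nonempty A]

/-- Stochastic approximation along one path. If the noise series converges for each pair, adding
its tail `U k` to the error `Q k - Qstar` absorbs the noise and leaves an asynchronous contraction
perturbed by `U k → 0`. -/
lemma tendsto_of_noise_sum_tendsto {γ B : ℝ} (hγ0 : 0 ≤ γ) (hγ1 : γ < 1) {R Qstar : S → A → ℝ}
    (hstar : M.bellmanOp R γ Qstar = Qstar) {Q α η : ℕ → S → A → ℝ}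
    (hB : ∀ k s a, |Q k s a| ≤ B) (hα0 : ∀ k s a, 0 ≤ α k s a) (hα1 : ∀ k s a, α k s a ≤ 1)
    (hα : ∀ s a, Tendsto (fun n => ∑ k ∈ Finset.range n, α k s a) atTop atTop)
    (hη : ∀ s a, ∃ l, Tendsto (fun n => ∑ k ∈ Finset.range n, η k s a) atTop (𝓝 l))
    (hQ : ∀ k s a, Q (k + 1) s a =
      (1 - α k s a) * Q k s a + α k s a * M.bellmanOp R γ (Q k) s a + η k s a) (s : S) (a : A) :
    Tendsto (fun k => Q k s a) atTop (𝓝 (Qstar s a)) := by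
  choose l hl using hη
  set U : ℕ → S × A → ℝ := fun n x => l x.1 x.2 - ∑ k ∈ Finset.range n, η k x.1 x.2 with hU
  have hU0 : ∀ x, Tendsto (fun n => U n x) atTop (𝓝 0) := fun x => by
    simpa using (tendsto_const_nhds (x := l x.1 x.2)).sub (hl x.1 x.2)
  set e : ℕ → ℝ := fun n => ∑ x, |U n x| with he
  have he0 : Tendsto e atTop (𝓝 0) := by
    simpa using tendsto_finsetSum Finset.univ fun x _ => (hU0 x).abs
  have hUe : ∀ n x, |U n x| ≤ e n := fun n x =>
    Finset.single_le_sum (f := fun x => |U n x|) (fun _ _ => abs_nonneg _) (Finset.mem_univ x)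
  obtain ⟨E, hE⟩ := he0.bddAbove_range
  obtain ⟨D, hD⟩ := (Set.finite_range fun x : S × A => |Qstar x.1 x.2|).bddAbove
  have hY := tendsto_zero_of_asynchronous_contraction
    (Y := fun k (x : S × A) => Q k x.1 x.2 - Qstar x.1 x.2 + U k x)
    (α := fun k x => α k x.1 x.2) (ε := fun k => (γ + 1) * e k) (B := B + D + E) hγ0 hγ1
    (by simpa using he0.const_mul (γ + 1))
    (fun k x => (abs_add_le _ _).trans (add_le_add ((abs_sub _ _).trans
      (add_le_add (hB k _ _) (hD ⟨x, rfl⟩))) ((hUe k x).trans (hE ⟨k, rfl⟩))))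
    (fun k x => hα0 k _ _) (fun k x => hα1 k _ _) (fun x => hα _ _) ?_ (s, a)
  · have := (hY.sub (hU0 (s, a))).add_const (Qstar s a)
    simpa using this
  · intro k x b hb
    have hdist : ∀ s a, |Q k s a - Qstar s a| ≤ b + e k := fun s a => by
      have h1 := abs_sub (Q k s a - Qstar s a + U k (s, a)) (U k (s, a))
      rw [add_sub_cancel_right] at h1
      linarith [hb (s, a), hUe k (s, a)]
    have hcontr := M.abs_bellmanOp_sub_le hγ0 R hdist x.1 x.2
    rw [hstar] at hcontr
    have hUs : U k x = η k x.1 x.2 + U (k + 1) x := by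
      simp only [hU, Finset.sum_range_succ]
      ring
    have hrec : Q (k + 1) x.1 x.2 - Qstar x.1 x.2 + U (k + 1) x =
        (1 - α k x.1 x.2) * (Q k x.1 x.2 - Qstar x.1 x.2 + U k x) +
          α k x.1 x.2 * (M.bellmanOp R γ (Q k) x.1 x.2 - Qstar x.1 x.2 + U k x) := by
      rw [hQ]
      linear_combination (-1 : ℝ) * hUs
    rw [hrec]
    refine (abs_add_le _ _).trans ?_
    rw [abs_mul, abs_mul, abs_of_nonneg (hα0 k x.1 x.2),
      abs_of_nonneg (sub_nonneg.2 (hα1 k x.1 x.2))]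
    refine add_le_add_right (mul_le_mul_of_nonneg_left ?_ (hα0 k x.1 x.2)) _
    refine (abs_add_le _ _).trans ?_
    linarith [hUe k x]

end PeakMDP

section QLearning

variable {S A : Type*} [DecidableEq S] [DecidableEq A] {R : S → A → ℝ} {γ : ℝ}

lemma stepSize_mem_Icc {st : ℕ → S} {act : ℕ → A} {α : ℕ → ℝ}
    (hα : ∀ k, α k ∈ Set.Icc (0 : ℝ) 1) (k : ℕ) (s : S) (a : A) :
    stepSize st act α k s a ∈ Set.Icc (0 : ℝ) 1 := by
  unfold stepSize
  split_ifs
  · exact hα k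
  · simp

/-- Every step size is the step size of the pair visited at that time, to which the Robbins–Monro
conditions apply. -/
lemma IsRobbinsMonro.mem_Icc {st : ℕ → S} {act : ℕ → A} {α : ℕ → ℝ} (h : IsRobbinsMonro st act α)
    (k : ℕ) : α k ∈ Set.Icc (0 : ℝ) 1 := by
  have := (h (st k) (act k)).1 k
  simp only [stepSize, and_self, if_true] at this
  exact ⟨this.1, this.2.le⟩

lemma measurable_stepSize {Ω : Type*} [MeasurableSpace S] [MeasurableSingletonClass S]
    [MeasurableSpace A] [MeasurableSingletonClass A] {m : MeasurableSpace Ω} {st : ℕ → Ω → S}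
    {act : ℕ → Ω → A} {α : ℕ → Ω → ℝ} {k : ℕ}
    (hs : Measurable[m] (st k)) (ha : Measurable[m] (act k))
    (hα : Measurable[m] (α k)) (s : S) (a : A) :
    Measurable[m] fun ω =>
      stepSize (fun k => st k ω) (fun k => act k ω) (fun k => α k ω) k s a :=
  Measurable.ite ((hs (measurableSet_singleton s)).inter (ha (measurableSet_singleton a))) hα
    measurable_const

/-- A Q-learning step is a relaxed Bellman step plus the sampling error of the next state, written
as a combination of centred indicators. -/
lemma qLearning_succ_eq [Fintype S] {J : ℕ} (M : PeakMDP S A J) (st : ℕ → S) (act : ℕ → A)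
    (α : ℕ → ℝ) (Q₀ : S → A → ℝ) (k : ℕ) (s : S) (a : A) :
    qLearning R γ st act α Q₀ (k + 1) s a =
      (1 - stepSize st act α k s a) * qLearning R γ st act α Q₀ k s a +
        stepSize st act α k s a * M.bellmanOp R γ (qLearning R γ st act α Q₀ k) s a +
      ∑ s', (stepSize st act α k s a * γ * ⨆ a', qLearning R γ st act α Q₀ k s' a') *
        ((if st (k + 1) = s' then 1 else 0) - (M.transition (st k) (act k) s').toReal) := by
  rw [qLearning]
  by_cases h : st k = s ∧ act k = a
  · obtain ⟨rfl, rfl⟩ := h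
    simp only [PeakMDP.bellmanOp, pmfExp, mul_sub, mul_ite, mul_one, mul_zero,
      Finset.sum_sub_distrib, Finset.sum_ite_eq, Finset.mem_univ, if_true, mul_add, Finset.mul_sum]
    rw [Finset.sum_congr rfl fun s' _ => show
      stepSize st act α k (st k) (act k) * (γ * ((M.transition (st k) (act k) s').toReal *
        ⨆ a', qLearning R γ st act α Q₀ k s' a')) =
      (stepSize st act α k (st k) (act k) * γ * ⨆ a', qLearning R γ st act α Q₀ k s' a') *
        (M.transition (st k) (act k) s').toReal by ring]
    ring
  · simp [stepSize, h]

variable [Fintype A]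

section Measurability

variable {Ω : Type*} [Fintype S] [MeasurableSpace S] [MeasurableSingletonClass S]
  [MeasurableSpace A] [MeasurableSingletonClass A]
  {m : MeasurableSpace Ω} {st : ℕ → Ω → S} {act : ℕ → Ω → A} {α : ℕ → Ω → ℝ}

/-- The iterates are adapted. -/
lemma measurable_qLearning {ℱ : Filtration ℕ m} (hs : ∀ k, Measurable[ℱ k] (st k))
    (ha : ∀ k, Measurable[ℱ k] (act k)) (hα : ∀ k, Measurable[ℱ k] (α k)) (Q₀ : S → A → ℝ)
    (k : ℕ) (s : S) (a : A) :
    Measurable[ℱ k] fun ω => qLearning R γ (fun k => st k ω) (fun k => act k ω)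
      (fun k => α k ω) Q₀ k s a := by
  induction k generalizing s a with
  | zero => exact measurable_const
  | succ k ih =>
    have hle : ℱ k ≤ ℱ (k + 1) := ℱ.mono k.le_succ
    have hstep := (measurable_stepSize (hs k) (ha k) (hα k) s a).mono hle le_rfl
    have hmax : Measurable[ℱ (k + 1)] fun ω => ⨆ a', qLearning R γ (fun k => st k ω)
        (fun k => act k ω) (fun k => α k ω) Q₀ k (st (k + 1) ω) a' := by
      have : (fun ω => ⨆ a', qLearning R γ (fun k => st k ω)
          (fun k => act k ω) (fun k => α k ω) Q₀ k (st (k + 1) ω) a') = fun ω =>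
          ∑ s', if st (k + 1) ω = s' then ⨆ a', qLearning R γ (fun k => st k ω)
            (fun k => act k ω) (fun k => α k ω) Q₀ k s' a' else 0 := by
        funext ω
        simp
      rw [this]
      refine Finset.measurable_fun_sum _ fun s' _ => Measurable.ite
        (hs (k + 1) (measurableSet_singleton s'))
        (Measurable.iSup fun a' => (ih s' a').mono hle le_rfl) measurable_const
    simp only [qLearning]
    exact ((measurable_const.sub hstep).mul ((ih s a).mono hle le_rfl)).add
      (hstep.mul ((hmax.const_mul γ).const_add (R s a)))

end Measurability

variable [Nonempty A]

lemma abs_qLearning_le {B : ℝ} (hγ : 0 ≤ γ) {st : ℕ → S} {act : ℕ → A} {α : ℕ → ℝ} {Q₀ : S → A → ℝ}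
    (hα : ∀ k, α k ∈ Set.Icc (0 : ℝ) 1) (h0 : ∀ s a, |Q₀ s a| ≤ B)
    (hR : ∀ s a, |R s a| + γ * B ≤ B) (k : ℕ) (s : S) (a : A) :
    |qLearning R γ st act α Q₀ k s a| ≤ B := by
  induction k generalizing s a with
  | zero => exact h0 s a
  | succ k ih =>
    obtain ⟨h1, h2⟩ := stepSize_mem_Icc (st := st) (act := act) hα k s a
    have h3 : |R s a + γ * ⨆ a', qLearning R γ st act α Q₀ k (st (k + 1)) a'| ≤ B := by
      refine (abs_add_le _ _).trans (le_trans (add_le_add_right ?_ _) (hR s a))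
      rw [abs_mul, abs_of_nonneg hγ]
      exact mul_le_mul_of_nonneg_left (abs_iSup_le fun a' => ih _ _) hγ
    rw [qLearning]
    refine (abs_add_le _ _).trans ?_
    rw [abs_mul, abs_mul, abs_of_nonneg h1, abs_of_nonneg (sub_nonneg.2 h2)]
    nlinarith [mul_le_mul_of_nonneg_left h3 h1,
      mul_le_mul_of_nonneg_left (ih s a) (sub_nonneg.2 h2)]

end QLearning

section Convergence

variable {S A : Type*} {J : ℕ} {M : PeakMDP S A J} {Ω : Type*} {st : ℕ → Ω → S} {act : ℕ → Ω → A}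

/-- The indicator of the state at time `k + 1` being `s'`, minus its conditional probability. -/
noncomputable def transitionNoise [DecidableEq S] (M : PeakMDP S A J) (st : ℕ → Ω → S)
    (act : ℕ → Ω → A) (s' : S) (k : ℕ) (ω : Ω) : ℝ :=
  (if st (k + 1) ω = s' then 1 else 0) - (M.transition (st k ω) (act k ω) s').toReal

lemma abs_transitionNoise_le [DecidableEq S] (s' : S) (k : ℕ) (ω : Ω) :
    |transitionNoise M st act s' k ω| ≤ 1 := by
  have h1 : (M.transition (st k ω) (act k ω) s').toReal ≤ 1 := by
    simpa using ENNReal.toReal_mono ENNReal.one_ne_top (PMF.coe_le_one _ s')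
  have h0 : 0 ≤ (M.transition (st k ω) (act k ω) s').toReal := ENNReal.toReal_nonneg
  unfold transitionNoise
  rw [abs_le]
  split_ifs <;> constructor <;> linarith

namespace IsControlledProcess

variable [MeasurableSpace S] [MeasurableSingletonClass S] [MeasurableSpace A]
  {mΩ : MeasurableSpace Ω} {μ : Measure Ω} {ℱ : Filtration ℕ mΩ}

lemma measurable_transition [Fintype S] [Fintype A] [MeasurableSingletonClass A]
    (h : IsControlledProcess M μ ℱ st act) (s' : S) (k : ℕ) :
    Measurable[ℱ k] fun ω => (M.transition (st k ω) (act k ω) s').toReal :=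
  (measurable_of_countable fun x : S × A => (M.transition x.1 x.2 s').toReal).comp
    ((h.measurable_state k).prodMk (h.measurable_action k))

variable [DecidableEq S]

lemma measurable_indicator (h : IsControlledProcess M μ ℱ st act) (s' : S) (k : ℕ) :
    Measurable[ℱ k] fun ω => if st k ω = s' then (1 : ℝ) else 0 :=
  Measurable.ite (h.measurable_state k (measurableSet_singleton s')) measurable_const
    measurable_const

variable [Fintype S] [Fintype A] [MeasurableSingletonClass A]

lemma measurable_transitionNoise (h : IsControlledProcess M μ ℱ st act) (s' : S) (k : ℕ) :
    Measurable[ℱ (k + 1)] (transitionNoise M st act s' k) :=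
  (h.measurable_indicator s' (k + 1)).sub
    ((h.measurable_transition s' k).mono (ℱ.mono k.le_succ) le_rfl)

variable [IsProbabilityMeasure μ]

lemma condExp_transitionNoise (h : IsControlledProcess M μ ℱ st act) (s' : S) (k : ℕ) :
    μ[transitionNoise M st act s' k | ℱ k] =ᵐ[μ] 0 := by
  have hind : (fun ω => if st (k + 1) ω = s' then (1 : ℝ) else 0) =
      (st (k + 1) ⁻¹' {s'}).indicator fun _ => 1 := by
    classical
    funext ω
    rw [Set.indicator_apply]
    exact if_congr Iff.rfl rfl rfl
  have hi1 : Integrable (fun ω => if st (k + 1) ω = s' then (1 : ℝ) else 0) μ :=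
    Integrable.of_bound (C := 1)
      ((h.measurable_indicator s' (k + 1)).mono (ℱ.le _) le_rfl).aestronglyMeasurable
      (Eventually.of_forall fun ω => by split_ifs <;> simp)
  have hi2 : Integrable (fun ω => (M.transition (st k ω) (act k ω) s').toReal) μ :=
    Integrable.of_bound (C := 1)
      ((h.measurable_transition s' k).mono (ℱ.le _) le_rfl).aestronglyMeasurable
      (Eventually.of_forall fun ω => by
        rw [Real.norm_of_nonneg ENNReal.toReal_nonneg]
        simpa using ENNReal.toReal_mono ENNReal.one_ne_top (PMF.coe_le_one _ s'))
  have h1 := condExp_sub (μ := μ) hi1 hi2 (ℱ k)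
  rw [condExp_of_stronglyMeasurable (ℱ.le k) (h.measurable_transition s' k).stronglyMeasurable hi2,
    hind] at h1
  filter_upwards [h1, h.transition_law k s'] with ω h1 h2
  have hz := h1.trans (sub_eq_zero.2 h2)
  rw [← hind] at hz
  exact hz

variable [DecidableEq A] [Nonempty A]

/-- Q-learning with step sizes in `[0, 1]` on every path, where the iterates are bounded. -/
lemma tendsto_qLearning_of_mem_Icc (h : IsControlledProcess M μ ℱ st act) {γ : ℝ}
    (hγ0 : 0 ≤ γ) (hγ1 : γ < 1) {R Qstar : S → A → ℝ}
    (hstar : M.bellmanOp R γ Qstar = Qstar) {α : ℕ → Ω → ℝ} (Q₀ : S → A → ℝ)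
    (hαm : ∀ k, Measurable[ℱ k] (α k)) (hα : ∀ k ω, α k ω ∈ Set.Icc (0 : ℝ) 1)
    (hRM : ∀ᵐ ω ∂μ, IsRobbinsMonro (fun k => st k ω) (fun k => act k ω) (fun k => α k ω)) :
    ∀ᵐ ω ∂μ, ∀ s a, Tendsto (fun k => qLearning R γ (fun k => st k ω) (fun k => act k ω)
      (fun k => α k ω) Q₀ k s a) atTop (𝓝 (Qstar s a)) := by
  obtain ⟨b₀, hb₀⟩ := (Set.finite_range fun x : S × A => |Q₀ x.1 x.2|).bddAbove
  obtain ⟨b, hb⟩ := (Set.finite_range fun x : S × A => |R x.1 x.2|).bddAbove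
  -- The ball of radius `B` contains `Q₀` and is invariant, because `b + γ B ≤ B`.
  set B := max b₀ (b / (1 - γ))
  have hRB : ∀ s a, |R s a| + γ * B ≤ B := fun s a => by
    have h1 : |R s a| ≤ b := hb ⟨(s, a), rfl⟩
    have h2 := (div_le_iff₀ (by linarith : 0 < 1 - γ)).1 (le_max_right b₀ (b / (1 - γ)))
    linarith
  have hQB : ∀ ω k s a, |qLearning R γ (fun k => st k ω) (fun k => act k ω)
      (fun k => α k ω) Q₀ k s a| ≤ B := fun ω => abs_qLearning_le hγ0 (fun k => hα k ω)
    (fun s a => (hb₀ ⟨(s, a), rfl⟩ : |Q₀ s a| ≤ b₀).trans (le_max_left _ _)) hRB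
  set w : S → A → S → ℕ → Ω → ℝ := fun s a s' k ω =>
    stepSize (fun k => st k ω) (fun k => act k ω) (fun k => α k ω) k s a * γ *
      ⨆ a', qLearning R γ (fun k => st k ω) (fun k => act k ω) (fun k => α k ω) Q₀ k s' a' with hw
  have hwm : ∀ s a s' k, Measurable[ℱ k] (w s a s' k) := fun s a s' k =>
    ((measurable_stepSize (h.measurable_state k) (h.measurable_action k) (hαm k) s a).mul_const
      γ).mul (Measurable.iSup fun a' => measurable_qLearning h.measurable_state
        h.measurable_action hαm Q₀ k s' a')
  have hw2 : ∀ s a s', ∀ᵐ ω ∂μ, Summable fun k => w s a s' k ω ^ 2 := by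
    intro s a s'
    filter_upwards [hRM] with ω hω
    refine Summable.of_nonneg_of_le (fun _ => sq_nonneg _) (fun k => ?_)
      ((hω s a).2.2.mul_right ((γ * B) ^ 2))
    simp only [hw]
    rw [mul_assoc, mul_pow]
    refine mul_le_mul_of_nonneg_left (sq_le_sq' ?_ ?_) (sq_nonneg _)
    all_goals
      have := abs_le.1 (abs_iSup_le fun a' => hQB ω k s' a')
      nlinarith
  have hnoise : ∀ᵐ ω ∂μ, ∀ s a s', ∃ l, Tendsto (fun n => ∑ k ∈ Finset.range n,
      w s a s' k ω * transitionNoise M st act s' k ω) atTop (𝓝 l) :=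
    ae_all_iff.2 fun s => ae_all_iff.2 fun a => ae_all_iff.2 fun s' =>
      ae_tendsto_sum_mul_of_summable_sq (h.measurable_transitionNoise s')
        (abs_transitionNoise_le s') (h.condExp_transitionNoise s') (hwm s a s') (hw2 s a s')
  filter_upwards [hRM, hnoise] with ω hω hn
  refine M.tendsto_of_noise_sum_tendsto hγ0 hγ1 hstar (hQB ω)
    (fun k s a => (stepSize_mem_Icc (fun k => hα k ω) k s a).1)
    (fun k s a => (stepSize_mem_Icc (fun k => hα k ω) k s a).2) (fun s a => (hω s a).2.1)
    (fun s a => ?_) (fun k s a => qLearning_succ_eq M _ _ _ Q₀ k s a)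
  choose l hl using hn s a
  refine ⟨∑ s', l s', (tendsto_finsetSum Finset.univ fun s' _ => hl s').congr fun n => ?_⟩
  rw [Finset.sum_comm]
  rfl

/-- Almost surely the step sizes lie in `[0, 1]`, so clamping them to this interval changes the
iterates only on a null set. -/
lemma tendsto_qLearning (h : IsControlledProcess M μ ℱ st act) {γ : ℝ}
    (hγ0 : 0 ≤ γ) (hγ1 : γ < 1) {R Qstar : S → A → ℝ}
    (hstar : M.bellmanOp R γ Qstar = Qstar) {α : ℕ → Ω → ℝ} (Q₀ : S → A → ℝ)
    (hαm : ∀ k, Measurable[ℱ k] (α k))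
    (hRM : ∀ᵐ ω ∂μ, IsRobbinsMonro (fun k => st k ω) (fun k => act k ω) (fun k => α k ω)) :
    ∀ᵐ ω ∂μ, ∀ s a, Tendsto (fun k => qLearning R γ (fun k => st k ω) (fun k => act k ω)
      (fun k => α k ω) Q₀ k s a) atTop (𝓝 (Qstar s a)) := by
  have hclamp : ∀ᵐ ω ∂μ, (fun k => max 0 (min 1 (α k ω))) = fun k => α k ω := by
    filter_upwards [hRM] with ω hω
    funext k
    obtain ⟨h0, h1⟩ := hω.mem_Icc k
    rw [min_eq_right h1, max_eq_right h0]
  have key := h.tendsto_qLearning_of_mem_Icc hγ0 hγ1 hstar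
    (α := fun k ω => max 0 (min 1 (α k ω))) Q₀
    (fun k => measurable_const.max (measurable_const.min (hαm k)))
    (fun k ω => ⟨le_max_left _ _, max_le zero_le_one (min_le_left _ _)⟩) (by
      filter_upwards [hRM, hclamp] with ω hω hc
      rwa [hc])
  filter_upwards [key, hclamp] with ω hω hc
  rwa [hc] at hω

end IsControlledProcess

end Convergence

theorem mainTheorem2 {S A : Type*} {J : ℕ}
    [Fintype S] [DecidableEq S] [MeasurableSpace S] [MeasurableSingletonClass S]
    [Fintype A] [DecidableEq A] [MeasurableSpace A] [MeasurableSingletonClass A]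
    (M : PeakMDP S A J) (γ : ℝ) (hγ0 : 0 < γ) (hγ1 : γ < 1)
    (c : ℝ) (hr : ∀ s a, |M.reward s a| ≤ c) (hrj : ∀ j s a, |M.constr j s a| ≤ c)
    (hpos : ∀ s a, 0 < M.reward s a)
    (hunichain : M.IsUnichain)
    (s₀ : S) (hfeas : ∃ π : Policy S A, M.IsFeasible π s₀)
    (C : ℝ) (hC : C = c * γ / (1 - γ)) :
    ∃ Qstar : S → A → ℝ,
      M.IsBellmanSolution γ C Qstar ∧
      (∀ Q : S → A → ℝ, M.IsBellmanSolution γ C Q → Q = Qstar) ∧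
      (∀ (Ω : Type*) [mΩ : MeasurableSpace Ω] (μ : Measure Ω) [IsProbabilityMeasure μ]
        (ℱ : Filtration ℕ mΩ) (st : ℕ → Ω → S) (act : ℕ → Ω → A) (α : ℕ → Ω → ℝ)
        (Q₀ : S → A → ℝ),
        IsControlledProcess M μ ℱ st act →
        (∀ k, Measurable[ℱ k] (α k)) →
        (∀ᵐ ω ∂μ, IsRobbinsMonro (fun k => st k ω) (fun k => act k ω) (fun k => α k ω)) →
        ∀ᵐ ω ∂μ, ∀ s a, Tendsto
          (fun k => qLearning (M.truncReward C) γ (fun k => st k ω) (fun k => act k ω)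
            (fun k => α k ω) Q₀ k s a) atTop (𝓝 (Qstar s a))) ∧
      (∃ π : Policy S A, IsGreedy Qstar π) ∧
      ∀ π : Policy S A, IsGreedy Qstar π → M.IsOptimal γ π s₀ := by
  obtain ⟨π₀, hπ₀⟩ := hfeas
  have : Nonempty A := ⟨(π₀ s₀).support_nonempty.some⟩
  have hcontr := M.contractingWith_bellmanOp hγ0.le hγ1 (M.truncReward C)
  have hstar := hcontr.fixedPoint_isFixedPt
  refine ⟨hcontr.fixedPoint, M.isBellmanSolution_iff.2 hstar,
    fun Q hQ => hcontr.fixedPoint_unique (M.isBellmanSolution_iff.1 hQ), ?_,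
    exists_isGreedy _, fun π hπ => ?_⟩
  · intro Ω _ μ _ ℱ st act α Q₀ hproc hα hRM
    exact hproc.tendsto_qLearning hγ0.le hγ1 hstar Q₀ hα hRM
  · exact PeakMDP.isOptimal_of_isGreedy hγ0 hγ1 hr hpos
      (fun s => PeakMDP.exists_admissible hunichain hπ₀ s) hC hstar hπ
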